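/- **Definitions.** A finite convex geometry $(J,\overline{\phantom{x}})$ is a closure operator on the subsets of a finite set $J$ satisfying the anti-exchange axiom: for closed $A\subseteq J$ and $x\ne y$ in $J$, if $x\in\overline{A\cup\{y\}}$ and $x\notin A$, then $y\notin\overline{A\cup\{x\}}$. A set $D\subseteq J$ is dependent if $x\in\overline{D\setminus\{x\}}$ for some $x\in D$; a circuit is an inclusion-minimal dependent set; a convex $4$-geometry is a convex geometry all of whose circuits have exactly four elements. The layers are defined recursively: with $J_0=J$, let $L_n=\{x\in J_n : x\notin\overline{J_n\setminus\{x\}}\}$ and $J_{n+1}=J_n\setminus L_n$. The geometry has two layers if $L_0,L_1\neq\emptyset$ and $J_2=\emptyset$. A realization of $(J,\overline{\phantom{x}})$ is an injective map $f:J\to\mathbb{R}^2$ such that no three of the points $f(a)$, $a\in J$, are collinear and $f(\overline{Y})=\operatorname{conv}(f(Y))\cap f(J)$ for all $Y\subseteq J$; the geometry is realizable if it has a realization. Each realization $f$ induces an order type $t_f$, the function that sends a triple $(a,b,c)$ of distinct elements of $J$ to $1$ or $-1$ according to whether $f(a),f(b),f(c)$ are oriented anticlockwise or clockwise. Two order types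 $t_1,t_2$ on $J$ are equivalent if there is a bijection $\delta:J\to J$ with $t_2(a,b,c)=t_1(\delta a,\delta b,\delta c)$ for all such triples. Let $\mathrm{OT}(J)$ be the set of equivalence classes of the order types induced by the realizations of $(J,\overline{\phantom{x}})$. **Proposition.** For every integer $k\ge 0$ there is a series $\{J(p) : p>k\}$ of realizable finite convex $4$-geometries with two layers such that $$0<\lim_{p\to\infty}\frac{|J(p)|}{p}<\infty\qquad\text{and}\qquad 0<\lim_{p\to\infty}\frac{|\mathrm{OT}(J(p))|}{p^k}<\infty,$$ where in particular both limits exist. -/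

import Mathlib

open Set Filter Topology

/-- A convex geometry `(J, -)`: a closure operator on the subsets of `J` with the anti-exchange
property. -/
def IsConvexGeometry {J : Type*} (cl : ClosureOperator (Set J)) : Prop :=
  ∀ (A : Set J) (x y : J), cl A = A → x ≠ y →
    x ∈ cl (A ∪ {y}) → x ∉ A → y ∉ cl (A ∪ {x})

/-- A set `D` is dependent if some element of `D` lies in the closure of the others. -/
def IsDependent {J : Type*} (cl : ClosureOperator (Set J)) (D : Set J) : Prop :=
  ∃ x ∈ D, x ∈ cl (D \ {x})

/-- A circuit is an inclusion-minimal dependent set. -/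
def IsCircuit {J : Type*} (cl : ClosureOperator (Set J)) (C : Set J) : Prop :=
  Minimal (IsDependent cl) C

/-- A convex `4`-geometry: a convex geometry all of whose circuits have exactly four elements. -/
def IsConvexFourGeometry {J : Type*} (cl : ClosureOperator (Set J)) : Prop :=
  IsConvexGeometry cl ∧ ∀ C : Set J, IsCircuit cl C → C.ncard = 4

/-- The extreme points of the geometry induced on the subset `A`. (The induced closure operator is
`Y ↦ cl Y ∩ A`, so for `x ∈ A` the condition is `x ∉ cl (A \ {x})`.) -/
def extremePointsOf {J : Type*} (cl : ClosureOperator (Set J)) (A : Set J) : Set J :=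
  {x ∈ A | x ∉ cl (A \ {x})}

/-- `remainingSet cl n` is what remains of `J` when the layers `L_0, …, L_{n-1}` are removed. -/
def remainingSet {J : Type*} (cl : ClosureOperator (Set J)) : ℕ → Set J
  | 0 => Set.univ
  | n + 1 => remainingSet cl n \ extremePointsOf cl (remainingSet cl n)

/-- The layer `L_n`: the extreme points of the geometry induced on `remainingSet cl n`. -/
def layer {J : Type*} (cl : ClosureOperator (Set J)) (n : ℕ) : Set J :=
  extremePointsOf cl (remainingSet cl n)

/-- The complete family of layers is `L_0, …, L_{m-1}`: these `m` layers are nonempty and they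
exhaust `J`. -/
def HasExactlyLayers {J : Type*} (cl : ClosureOperator (Set J)) (m : ℕ) : Prop :=
  (∀ i < m, (layer cl i).Nonempty) ∧ remainingSet cl m = ∅

/-- The Euclidean plane. -/
abbrev Plane : Type := EuclideanSpace ℝ (Fin 2)

/-- Twice the signed area of the triangle `x, y, z`; it is positive iff `x, y, z` is anticlockwise,
negative iff it is clockwise, and zero iff the points are collinear. -/
def signedArea (x y z : Plane) : ℝ :=
  (y 0 - x 0) * (z 1 - x 1) - (y 1 - x 1) * (z 0 - x 0)

open Classical in
/-- The orientation sign of noncollinear points: `1` if anticlockwise, `-1` if clockwise.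
(It is only used for noncollinear points.) -/
noncomputable def orientationSign (x y z : Plane) : ℤˣ :=
  if 0 < signedArea x y z then 1 else -1

/-- The points `f a`, `a ∈ J`, are distinct and no three of them are on a line. -/
def InGeneralPosition {J : Type*} (f : J → Plane) : Prop :=
  Function.Injective f ∧
    ∀ a b c : J, a ≠ b → a ≠ c → b ≠ c → ¬ Collinear ℝ {f a, f b, f c}

/-- `f` realizes `(J, cl)`: it is an isomorphism from `(J, cl)` to the convex geometry
`Y ↦ ch(Y) ∩ X` of the point configuration `X = f(J)` in general position. -/
def IsRealization {J : Type*} (cl : ClosureOperator (Set J)) (f : J → Plane) : Prop :=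
  InGeneralPosition f ∧
    ∀ Y : Set J, f '' (cl Y) = convexHull ℝ (f '' Y) ∩ Set.range f

/-- `(J, cl)` is realizable in the plane. -/
def IsRealizable {J : Type*} (cl : ClosureOperator (Set J)) : Prop :=
  ∃ f : J → Plane, IsRealization cl f

/-- `J[3]`: the ordered triples of distinct elements of `J`. -/
abbrev Triples (J : Type*) : Type _ := Fin 3 ↪ J

/-- The orientation function `t_f : J[3] → {1, -1}` of a configuration `f`. -/
noncomputable def orderTypeOf {J : Type*} (f : J → Plane) : Triples J → ℤˣ :=
  fun τ => orientationSign (f (τ 0)) (f (τ 1)) (f (τ 2))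

/-- The set of order types `t_f` induced by the realizations `f` of `(J, cl)`. -/
def orderTypes {J : Type*} (cl : ClosureOperator (Set J)) : Set (Triples J → ℤˣ) :=
  {t | ∃ f : J → Plane, IsRealization cl f ∧ t = orderTypeOf f}

/-- Equivalence of functions `J[3] → {1, -1}`: `t₂ = t₁ ∘ δ` for a bijection `δ : J → J`,
applied to triples componentwise. -/
def orderTypeSetoid (J : Type*) : Setoid (Triples J → ℤˣ) where
  r t₁ t₂ := ∃ δ : J ≃ J, ∀ τ : Triples J, t₂ τ = t₁ (τ.trans δ.toEmbedding)
  iseqv :=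
    { refl := fun _ => ⟨Equiv.refl J, fun _ => rfl⟩
      symm := by
        rintro t₁ t₂ ⟨δ, h⟩
        refine ⟨δ.symm, fun τ => ?_⟩
        rw [h]
        congr 1
        ext i
        simp
      trans := by
        rintro t₁ t₂ t₃ ⟨δ, h⟩ ⟨ε, h'⟩
        refine ⟨ε.trans δ, fun τ => ?_⟩
        rw [h', h]
        rfl }

/-- The equivalence classes of the order types induced by the realizations of `(J, cl)`. -/
def orderTypeClasses {J : Type*} (cl : ClosureOperator (Set J)) :
    Set (Quotient (orderTypeSetoid J)) :=
  Quotient.mk (orderTypeSetoid J) '' orderTypes cl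

/-- For finite `J` there are finitely many classes, so `Set.ncard` is their true number. -/
theorem orderTypeClasses_finite {J : Type*} [Finite J] (cl : ClosureOperator (Set J)) :
    (orderTypeClasses cl).Finite :=
  (Set.toFinite (orderTypes cl)).image _

/-- `g(p)` has order of growth exactly `p ^ k`: the limit of `g(p) / p ^ k` exists and is
positive and finite. -/
def HasGrowth (g : ℕ → ℕ) (k : ℕ) : Prop :=
  ∃ c : ℝ, 0 < c ∧ Tendsto (fun p : ℕ => (g p : ℝ) / (p : ℝ) ^ k) atTop (𝓝 c)

/-! Take a convex polygon and place a midpoint just inside some of its edges. A midpoint lies in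
every triangle on its edge and in no other triangle. The geometry thus records which midpoint
belongs to which pair of ends, and leaves the cyclic order of the polygon otherwise free. All
circuits consist of a midpoint, its two ends and one further point; the polygon is the first layer
and the midpoints are the second.

In any realization, reversing the signs of the triples formed by a midpoint and its ends gives the
orientation of points in convex position, that is, a cyclic order in which the neighbours of each
midpoint are its ends (`IsChirotope.isCyclicOrder`, `IsChirotope.adjacent_iff`). Conversely,
arrangements with this adjacency are realized near a parabola (`IsPlacement.isRealization`).

For the growth, take two edges meeting in a hub, `k` disjoint edges and `p` free points. The hub is
determined by the marking, so the cyclic order can be cut there. The ranks of the `k` midpoints away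
from the hub determine the order type up to equivalence, which gives at most `(p + 3k + 5).choose k`
classes. The numbers of free points before these midpoints are invariants, and every `k`-subset of
`{0, …, p - 1}` occurs, which gives at least `p.choose k` classes. Both bounds are asymptotic to `p
^ k / k!`. -/

/-! ### Markings and their convex geometries -/

/-- A marking of `J`: `IsMid x a b` says that `x` is the midpoint attached to the edge with
ends `a` and `b`. -/
structure Marking (J : Type*) where
  IsMid : J → J → J → Prop
  symm : ∀ {x a b}, IsMid x a b → IsMid x b a
  ends_ne : ∀ {x a b}, IsMid x a b → a ≠ b
  not_mid_end : ∀ {x a b c d}, IsMid x a b → ¬ IsMid a c d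
  ends_unique : ∀ {x a b c d}, IsMid x a b → IsMid x c d → (c = a ∧ d = b) ∨ (c = b ∧ d = a)
  mid_unique : ∀ {x y a b}, IsMid x a b → IsMid y a b → x = y

namespace Marking

variable {J : Type*} (M : Marking J)

theorem mid_ne_left {x a b : J} (h : M.IsMid x a b) : x ≠ a := by
  rintro rfl
  exact M.not_mid_end h h

theorem mid_ne_right {x a b : J} (h : M.IsMid x a b) : x ≠ b :=
  M.mid_ne_left (M.symm h)

/-- The midpoints that are added to `Y`. -/
def added (Y : Set J) : Set J :=
  {x | ∃ a b z, M.IsMid x a b ∧ a ∈ Y ∧ b ∈ Y ∧ z ∈ Y ∧ z ≠ a ∧ z ≠ b}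

/-- A midpoint is in the closure of every set of at least three points containing the ends of its
edge. -/
def closure : ClosureOperator (Set J) where
  toFun Y := Y ∪ M.added Y
  monotone' := by
    rintro Y Z h x (hx | ⟨a, b, z, hm, ha, hb, hz, hza, hzb⟩)
    · exact Or.inl (h hx)
    · exact Or.inr ⟨a, b, z, hm, h ha, h hb, h hz, hza, hzb⟩
  le_closure' := fun Y => subset_union_left
  idempotent' := by
    intro Y
    refine subset_antisymm ?_ subset_union_left
    rintro x (hx | ⟨a, b, z, hm, ha, hb, hz, hza, hzb⟩)
    · exact hx
    have end_mem : ∀ {a b}, M.IsMid x a b → a ∈ Y ∪ M.added Y → a ∈ Y := by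
      rintro a b hm (h | ⟨_, _, _, h, _⟩)
      · exact h
      · exact (M.not_mid_end hm h).elim
    have ha' := end_mem hm ha
    have hb' := end_mem (M.symm hm) hb
    rcases hz with hz | ⟨c, d, w, hm', hc, hd, hw, hwc, hwd⟩
    · exact Or.inr ⟨a, b, z, hm, ha', hb', hz, hza, hzb⟩
    -- The third point is itself an added midpoint. Either an end of its edge replaces it, or the
    -- two edges agree; then the midpoints agree and `x` was added already.
    · by_cases h1 : c ≠ a ∧ c ≠ b
      · exact Or.inr ⟨a, b, c, hm, ha', hb', hc, h1.1, h1.2⟩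
      by_cases h2 : d ≠ a ∧ d ≠ b
      · exact Or.inr ⟨a, b, d, hm, ha', hb', hd, h2.1, h2.2⟩
      have hcd := M.ends_ne hm'
      by_cases h3 : c = a
      · subst h3
        have : d = b := by
          by_contra h
          exact h2 ⟨hcd.symm, h⟩
        subst this
        have := M.mid_unique hm hm'
        subst this
        exact Or.inr ⟨_, _, w, hm', hc, hd, hw, hwc, hwd⟩
      · have h4 : c = b := by
          by_contra h
          exact h1 ⟨h3, h⟩
        subst h4
        have : d = a := by
          by_contra h
          exact h2 ⟨h, hcd.symm⟩
        subst this
        have := M.mid_unique hm (M.symm hm')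
        subst this
        exact Or.inr ⟨_, _, w, hm', hc, hd, hw, hwc, hwd⟩

theorem mem_closure_iff {Y : Set J} {x : J} :
    x ∈ M.closure Y ↔ x ∈ Y ∨
      ∃ a b z, M.IsMid x a b ∧ a ∈ Y ∧ b ∈ Y ∧ z ∈ Y ∧ z ≠ a ∧ z ≠ b := Iff.rfl

/-- Distinct midpoints have distinct edges, so an end of one edge can serve as the third point for
the other. -/
theorem exists_end_of_ne {x y a b c d : J} (h : M.IsMid x a b) (h' : M.IsMid y c d)
    (hxy : x ≠ y) : (c ≠ a ∧ c ≠ b) ∨ (d ≠ a ∧ d ≠ b) := by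
  by_contra! hc
  have hcd := M.ends_ne h'
  have key : (c = a ∧ d = b) ∨ (c = b ∧ d = a) := by grind
  rcases key with ⟨rfl, rfl⟩ | ⟨rfl, rfl⟩
  · exact hxy (M.mid_unique h h')
  · exact hxy (M.mid_unique h (M.symm h'))

/-- If `x` and `y` were each added with the help of the other, both would be midpoints whose ends
lie in `A`, as ends are never midpoints. The ends of the edge of `y` then supply a third point for
`x` within `A`. -/
theorem isConvexGeometry_closure : IsConvexGeometry M.closure := by
  intro A x y hA hxy hx hxA hy
  have hyA : y ∉ A := by
    intro h
    rw [union_eq_self_of_subset_right (singleton_subset_iff.2 h), hA] at hx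
    exact hxA hx
  rcases M.mem_closure_iff.1 hx with (h | h) | ⟨a, b, z, hm, ha, hb, -⟩
  · exact hxA h
  · exact hxy h
  rcases M.mem_closure_iff.1 hy with (h | h) | ⟨c, d, w, hm', hc, hd, -⟩
  · exact hyA h
  · exact hxy h.symm
  have ne_end : ∀ {u v s t : J}, M.IsMid u s t → ∀ {p q}, M.IsMid v p q → p ≠ u := by
    rintro u v s t h p q h' rfl
    exact M.not_mid_end h' h
  have ha' : a ∈ A := ha.resolve_right (ne_end hm' hm)
  have hb' : b ∈ A := hb.resolve_right (ne_end hm' (M.symm hm))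
  have hc' : c ∈ A := hc.resolve_right (ne_end hm hm')
  have hd' : d ∈ A := hd.resolve_right (ne_end hm (M.symm hm'))
  apply hxA
  rw [← hA]
  rcases M.exists_end_of_ne hm hm' hxy with ⟨h1, h2⟩ | ⟨h1, h2⟩
  · exact Or.inr ⟨a, b, c, hm, ha', hb', hc', h1, h2⟩
  · exact Or.inr ⟨a, b, d, hm, ha', hb', hd', h1, h2⟩

theorem isConvexFourGeometry_closure : IsConvexFourGeometry M.closure := by
  refine ⟨M.isConvexGeometry_closure, fun C hC => ?_⟩
  obtain ⟨x, hxC, hx⟩ := hC.prop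
  rcases M.mem_closure_iff.1 hx with h | ⟨a, b, z, hm, ha, hb, hz, hza, hzb⟩
  · exact (h.2 rfl).elim
  have hxz : z ≠ x := hz.2
  have hxa := M.mid_ne_left hm
  have hxb := M.mid_ne_right hm
  have hab := M.ends_ne hm
  have hdep : IsDependent M.closure {x, a, b, z} := by
    refine ⟨x, by simp, Or.inr ⟨a, b, z, hm, ?_, ?_, ?_, hza, hzb⟩⟩ <;> simp <;> tauto
  have hsub : ({x, a, b, z} : Set J) ⊆ C := by
    rintro y (rfl | rfl | rfl | rfl)
    exacts [hxC, ha.1, hb.1, hz.1]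
  have hEq : C = {x, a, b, z} := subset_antisymm (hC.le_of_le hdep hsub) hsub
  rw [hEq, ncard_insert_of_notMem (by simp; tauto), ncard_insert_of_notMem (by simp; tauto),
    ncard_pair hzb.symm]

/-- The extreme points are exactly the non-midpoints. Once they are removed no end of an edge is
left, so nothing is added to any set of midpoints. -/
theorem hasExactlyLayers_closure (hne : ∃ x a b, M.IsMid x a b)
    (hthird : ∀ a b x : J, ∃ z, z ≠ a ∧ z ≠ b ∧ z ≠ x) : HasExactlyLayers M.closure 2 := by
  have h0 : ∀ x, x ∈ extremePointsOf M.closure Set.univ ↔ ¬ ∃ a b, M.IsMid x a b := by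
    intro x
    simp only [extremePointsOf, mem_ofPred_eq, mem_univ, true_and, mem_closure_iff, not_iff_not]
    constructor
    · rintro (h | ⟨a, b, z, h, -⟩)
      · exact (h.2 rfl).elim
      · exact ⟨a, b, h⟩
    · rintro ⟨a, b, h⟩
      obtain ⟨z, h1, h2, h3⟩ := hthird a b x
      exact Or.inr ⟨a, b, z, h, ⟨trivial, (M.mid_ne_left h).symm⟩,
        ⟨trivial, (M.mid_ne_right h).symm⟩, ⟨trivial, h3⟩, h1, h2⟩
  have hR1 : remainingSet M.closure 1 = {x | ∃ a b, M.IsMid x a b} := by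
    ext x
    simp only [remainingSet, Set.mem_sdiff, mem_univ, true_and, h0, not_not, mem_ofPred_eq]
  have hL1 : layer M.closure 1 = remainingSet M.closure 1 := by
    refine subset_antisymm (fun x hx => hx.1) fun x hx => ⟨hx, ?_⟩
    rintro (h | ⟨a, b, z, h, ha, -⟩)
    · exact h.2 rfl
    · have := ha.1
      rw [hR1] at this
      obtain ⟨c, d, h'⟩ := this
      exact M.not_mid_end h h'
  obtain ⟨x, a, b, h⟩ := hne
  constructor
  · intro i hi
    interval_cases i
    · exact ⟨a, (h0 a).2 fun ⟨c, d, h'⟩ => M.not_mid_end h h'⟩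
    · rw [hL1, hR1]
      exact ⟨x, a, b, h⟩
  · change remainingSet M.closure 1 \ layer M.closure 1 = ∅
    rw [hL1, Set.sdiff_self]

end Marking

/-! ### Signed areas and triangles in the plane -/

theorem signedArea_rotate (x y z : Plane) : signedArea x y z = signedArea y z x := by
  simp only [signedArea]; ring

theorem signedArea_swap (x y z : Plane) : signedArea x z y = -signedArea x y z := by
  simp only [signedArea]; ring

theorem signedArea_eq_sum (x a b c : Plane) :
    signedArea a b c = signedArea x a b + signedArea x b c + signedArea x c a := by
  simp only [signedArea]; ring

theorem collinear_iff_signedArea_eq_zero {x y z : Plane} :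
    Collinear ℝ {x, y, z} ↔ signedArea x y z = 0 := by
  rw [collinear_iff_of_mem (p₀ := x) (by simp)]
  constructor
  · rintro ⟨v, hv⟩
    obtain ⟨r, hr⟩ := hv y (by simp)
    obtain ⟨s, hs⟩ := hv z (by simp)
    simp only [signedArea, hr, hs, vadd_eq_add, PiLp.add_apply, PiLp.smul_apply, smul_eq_mul]
    ring
  · intro h
    by_cases hxy : y = x
    · refine ⟨z - x, ?_⟩
      rintro p (rfl | rfl | rfl)
      · exact ⟨0, by simp⟩
      · exact ⟨0, by simp [hxy]⟩
      · exact ⟨1, by simp⟩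
    · refine ⟨y - x, ?_⟩
      rintro p (rfl | rfl | hp)
      · exact ⟨0, by simp⟩
      · exact ⟨1, by simp⟩
      · rw [mem_singleton_iff.1 hp]
        have hne : y 0 - x 0 ≠ 0 ∨ y 1 - x 1 ≠ 0 := by
          by_contra! hc
          apply hxy
          ext i
          fin_cases i
          · exact sub_eq_zero.1 hc.1
          · exact sub_eq_zero.1 hc.2
        simp only [signedArea] at h
        rcases hne with hne | hne
        · refine ⟨(z 0 - x 0) / (y 0 - x 0), ?_⟩
          ext i
          fin_cases i <;> simp <;> field_simp <;> linarith
        · refine ⟨(z 1 - x 1) / (y 1 - x 1), ?_⟩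
          ext i
          fin_cases i <;> simp <;> field_simp <;> linarith

theorem mem_convexHull_triple_iff {x a b c : Plane} :
    x ∈ convexHull ℝ {a, b, c} ↔ ∃ r s t : ℝ, 0 ≤ r ∧ 0 ≤ s ∧ 0 ≤ t ∧ r + s + t = 1 ∧
      r • a + s • b + t • c = x := by
  constructor
  · intro hx
    refine convexHull_min (t := {x | ∃ r s t : ℝ, 0 ≤ r ∧ 0 ≤ s ∧ 0 ≤ t ∧ r + s + t = 1 ∧
      r • a + s • b + t • c = x}) ?_ ?_ hx
    · rintro y (rfl | rfl | rfl)
      exacts [⟨1, 0, 0, by simp⟩, ⟨0, 1, 0, by simp⟩, ⟨0, 0, 1, by simp⟩]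
    · rintro _ ⟨r, s, t, hr, hs, ht, hsum, rfl⟩ _ ⟨r', s', t', hr', hs', ht', hsum', rfl⟩
        p q hp hq hpq
      refine ⟨p * r + q * r', p * s + q * s', p * t + q * t', by positivity, by positivity,
        by positivity, ?_, by module⟩
      linear_combination p * hsum + q * hsum' + hpq
  · rintro ⟨r, s, t, hr, hs, ht, hsum, rfl⟩
    have key := (convex_convexHull ℝ {a, b, c}).sum_mem (t := Finset.univ) (w := ![r, s, t])
      (z := ![a, b, c]) (by simp [Fin.forall_fin_succ, hr, hs, ht])
      (by simpa [Fin.sum_univ_three] using hsum)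
      (fun i _ => subset_convexHull ℝ _ (by fin_cases i <;> simp))
    simpa [Fin.sum_univ_three] using key

/-- The areas at `x`, divided by the area of the whole triangle, are the barycentric coordinates of
`x`. -/
theorem mem_convexHull_triple_of_pos {x a b c : Plane} (h1 : 0 < signedArea x a b)
    (h2 : 0 < signedArea x b c) (h3 : 0 < signedArea x c a) : x ∈ convexHull ℝ {a, b, c} := by
  rw [mem_convexHull_triple_iff]
  have hD := signedArea_eq_sum x a b c
  have hD0 : 0 < signedArea a b c := by linarith
  refine ⟨signedArea x b c / signedArea a b c, signedArea x c a / signedArea a b c,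
    signedArea x a b / signedArea a b c, by positivity, by positivity, by positivity, ?_, ?_⟩
  · field_simp; linarith
  · ext i
    fin_cases i <;> simp <;> field_simp <;> simp only [signedArea] <;> ring

/-- A point in general position with respect to a triangle that lies in the triangle sees its
vertices in the order of their orientation. -/
theorem signedArea_pos_of_mem_convexHull {x a b c : Plane} (hx : x ∈ convexHull ℝ {a, b, c})
    (h1 : 0 < signedArea x a b) (h2 : signedArea x b c ≠ 0) (h3 : signedArea x c a ≠ 0) :
    0 < signedArea x b c ∧ 0 < signedArea x c a ∧ 0 < signedArea a b c := by
  rw [mem_convexHull_triple_iff] at hx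
  obtain ⟨r, s, t, hr, hs, ht, hsum, rfl⟩ := hx
  have hr' : r = 1 - s - t := by linarith
  have e1 : signedArea (r • a + s • b + t • c) a b = t * signedArea a b c := by
    subst hr'; simp [signedArea]; ring
  have e2 : signedArea (r • a + s • b + t • c) b c = r * signedArea a b c := by
    subst hr'; simp [signedArea]; ring
  have e3 : signedArea (r • a + s • b + t • c) c a = s * signedArea a b c := by
    subst hr'; simp [signedArea]; ring
  rw [e1] at h1
  rw [e2] at h2 ⊢
  rw [e3] at h3 ⊢
  have hD : 0 < signedArea a b c := pos_of_mul_pos_right h1 ht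
  have hr0 : r ≠ 0 := left_ne_zero_of_mul h2
  have hs0 : s ≠ 0 := left_ne_zero_of_mul h3
  exact ⟨by positivity, by positivity, hD⟩

theorem notMem_convexHull_of_lt {S : Set Plane} {x : Plane} (m : ℝ)
    (h : ∀ y ∈ S, x 1 - m * x 0 < y 1 - m * y 0) : x ∉ convexHull ℝ S := by
  have hlin : IsLinearMap ℝ fun y : Plane => y 1 - m * y 0 :=
    ⟨fun y z => by simp; ring, fun c y => by simp; ring⟩
  intro hx
  exact lt_irrefl (x 1 - m * x 0) (convexHull_min (t := {y : Plane | x 1 - m * x 0 < y 1 - m * y 0})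
    h (convex_halfSpace_gt hlin _) hx)

theorem notMem_convexHull_of_gt {S : Set Plane} {x : Plane} (m : ℝ)
    (h : ∀ y ∈ S, y 1 - m * y 0 < x 1 - m * x 0) : x ∉ convexHull ℝ S := by
  have hlin : IsLinearMap ℝ fun y : Plane => y 1 - m * y 0 :=
    ⟨fun y z => by simp; ring, fun c y => by simp; ring⟩
  intro hx
  exact lt_irrefl (x 1 - m * x 0) (convexHull_min (t := {y : Plane | y 1 - m * y 0 < x 1 - m * x 0})
    h (convex_halfSpace_lt hlin _) hx)

/-! ### Realizations near a parabola -/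

namespace Marking

variable {J : Type*} (M : Marking J) 

open Classical in
/-- The points of a parabola at the integral abscissae `pos j`, the midpoints being lifted to
just above the chords of their edges. -/
noncomputable def parabola (pos : J → ℤ) (j : J) : Plane :=
  !₂[(pos j : ℝ), (pos j : ℝ) ^ 2 + if ∃ a b, M.IsMid j a b then 3 / 2 else 0]

@[simp]
theorem parabola_zero (pos : J → ℤ) (j : J) : M.parabola pos j 0 = pos j := rfl

theorem parabola_one_of_mid (pos : J → ℤ) {j a b : J} (h : M.IsMid j a b) :
    M.parabola pos j 1 = (pos j : ℝ) ^ 2 + 3 / 2 := by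
  simp [parabola, if_pos (⟨a, b, h⟩ : ∃ a b, M.IsMid j a b)]

theorem parabola_one_of_not_mid (pos : J → ℤ) {j : J} (h : ¬ ∃ a b, M.IsMid j a b) :
    M.parabola pos j 1 = (pos j : ℝ) ^ 2 := by
  simp [parabola, if_neg h]

theorem le_parabola_one (pos : J → ℤ) (j : J) : (pos j : ℝ) ^ 2 ≤ M.parabola pos j 1 := by
  by_cases h : ∃ a b, M.IsMid j a b
  · obtain ⟨a, b, h⟩ := h
    rw [M.parabola_one_of_mid pos h]; linarith
  · rw [M.parabola_one_of_not_mid pos h]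

/-- Positions on the line such that every midpoint is next to the ends of its edge. -/
structure IsPlacement (pos : J → ℤ) : Prop where
  injective : Function.Injective pos
  adjacent : ∀ {x a b}, M.IsMid x a b →
    (pos a = pos x - 1 ∧ pos b = pos x + 1) ∨ (pos a = pos x + 1 ∧ pos b = pos x - 1)

variable {M} {pos : J → ℤ}

/-- The orientation of the points of a placement, except for the triples of a midpoint and the ends
of its edge. -/
theorem IsPlacement.signedArea_pos (h : M.IsPlacement pos) {x y z : J} (hxy : pos x < pos y)
    (hyz : pos y < pos z) (hm : ¬ M.IsMid y x z) :
    0 < signedArea (M.parabola pos x) (M.parabola pos y) (M.parabola pos z) := by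
  have hx := M.le_parabola_one pos x
  have hz := M.le_parabola_one pos z
  have hxy' : (pos x : ℝ) + 1 ≤ pos y := by exact_mod_cast hxy
  have hyz' : (pos y : ℝ) + 1 ≤ pos z := by exact_mod_cast hyz
  obtain ⟨p, hp⟩ : ∃ p : ℝ, p = pos y - pos x := ⟨_, rfl⟩
  obtain ⟨q, hq⟩ : ∃ q : ℝ, q = pos z - pos y := ⟨_, rfl⟩
  have hp1 : 1 ≤ p := by linarith
  have hq1 : 1 ≤ q := by linarith
  have hp' : (pos x : ℝ) = pos y - p := by linarith
  have hq' : (pos z : ℝ) = pos y + q := by linarith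
  -- With gaps `p` and `q`, the chord over `y` runs `p * q` above the parabola. Only the lift of the
  -- middle point decreases the area.
  have key : signedArea (M.parabola pos x) (M.parabola pos y) (M.parabola pos z) =
      (p + q) * (p * q - (M.parabola pos y 1 - (pos y : ℝ) ^ 2)) +
        p * (M.parabola pos z 1 - (pos z : ℝ) ^ 2) +
        q * (M.parabola pos x 1 - (pos x : ℝ) ^ 2) := by
    simp only [signedArea, parabola_zero, hp', hq']
    ring
  rw [key]
  have hlift : M.parabola pos y 1 - (pos y : ℝ) ^ 2 < p * q := by
    by_cases hy : ∃ a b, M.IsMid y a b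
    · obtain ⟨a, b, hy⟩ := hy
      rw [M.parabola_one_of_mid pos hy]
      -- If both gaps were 1, the outer points would be the ends of the edge of `y`. Otherwise `p *
      -- q ≥ 2`, which exceeds the lift 3/2.
      have hgap : pos x + 2 ≤ pos y ∨ pos y + 2 ≤ pos z := by
        by_contra! hc
        have hx1 : pos x = pos y - 1 := by omega
        have hz1 : pos z = pos y + 1 := by omega
        rcases h.adjacent hy with ⟨ha, hb⟩ | ⟨ha, hb⟩
        · rw [h.injective (hx1.trans ha.symm), h.injective (hz1.trans hb.symm)] at hm
          exact hm hy
        · rw [h.injective (hx1.trans hb.symm), h.injective (hz1.trans ha.symm)] at hm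
          exact hm (M.symm hy)
      rcases hgap with hgap | hgap
      · have : (pos x : ℝ) + 2 ≤ pos y := by exact_mod_cast hgap
        nlinarith
      · have : (pos y : ℝ) + 2 ≤ pos z := by exact_mod_cast hgap
        nlinarith
    · rw [M.parabola_one_of_not_mid pos hy, sub_self]
      positivity
  have h1 := mul_pos (by linarith : 0 < p + q) (sub_pos.2 hlift)
  have h2 := mul_nonneg (by linarith : 0 ≤ p) (sub_nonneg.2 hz)
  have h3 := mul_nonneg (by linarith : 0 ≤ q) (sub_nonneg.2 hx)
  linarith

/-- Both gaps are 1 and the ends are not lifted, so the chord is 1 above the parabola at the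
midpoint, which is lifted by 3/2. -/
theorem IsPlacement.signedArea_neg (h : M.IsPlacement pos) {x y z : J} (hxy : pos x < pos y)
    (hm : M.IsMid y x z) :
    signedArea (M.parabola pos x) (M.parabola pos y) (M.parabola pos z) < 0 := by
  have hx : ¬ ∃ a b, M.IsMid x a b := fun ⟨_, _, h'⟩ => M.not_mid_end hm h'
  have hz : ¬ ∃ a b, M.IsMid z a b := fun ⟨_, _, h'⟩ => M.not_mid_end (M.symm hm) h'
  have hadj : pos x = pos y - 1 ∧ pos z = pos y + 1 := by
    rcases h.adjacent hm with h' | h' <;> omega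
  simp only [signedArea, parabola_zero, M.parabola_one_of_not_mid pos hx,
    M.parabola_one_of_not_mid pos hz, M.parabola_one_of_mid pos hm, hadj.1, hadj.2]
  push_cast
  ring_nf
  norm_num

theorem IsPlacement.signedArea_ne_zero (h : M.IsPlacement pos) {x y z : J} (hxy : x ≠ y)
    (hxz : x ≠ z) (hyz : y ≠ z) :
    signedArea (M.parabola pos x) (M.parabola pos y) (M.parabola pos z) ≠ 0 := by
  have sorted : ∀ {x y z : J}, pos x < pos y → pos y < pos z →
      signedArea (M.parabola pos x) (M.parabola pos y) (M.parabola pos z) ≠ 0 := by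
    intro x y z hxy hyz
    by_cases hm : M.IsMid y x z
    · exact (h.signedArea_neg hxy hm).ne
    · exact (h.signedArea_pos hxy hyz hm).ne'
  rcases lt_or_gt_of_ne (h.injective.ne hxy) with h1 | h1 <;>
  rcases lt_or_gt_of_ne (h.injective.ne hxz) with h2 | h2 <;>
  rcases lt_or_gt_of_ne (h.injective.ne hyz) with h3 | h3
  · exact sorted h1 h3
  · have := sorted h2 h3
    rwa [signedArea_swap, neg_ne_zero] at this
  · omega
  · have := sorted h2 h1
    rwa [signedArea_rotate] at this
  · have := sorted h1 h2
    rwa [signedArea_swap, neg_ne_zero, ← signedArea_rotate] at this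
  · omega
  · have := sorted h3 h2
    rwa [← signedArea_rotate] at this
  · have := sorted h3 h1
    rwa [signedArea_swap, neg_ne_zero, signedArea_rotate] at this

theorem IsPlacement.inGeneralPosition (h : M.IsPlacement pos) :
    InGeneralPosition (M.parabola pos) := by
  refine ⟨fun x y hxy => h.injective ?_, fun a b c hab hac hbc => ?_⟩
  · have : (pos x : ℝ) = pos y := congrArg (fun p : Plane => p 0) hxy
    exact_mod_cast this
  · rw [collinear_iff_signedArea_eq_zero]
    exact h.signedArea_ne_zero hab hac hbc

theorem IsPlacement.exists_ends (h : M.IsPlacement pos) {x : J} (hx : ∃ a b, M.IsMid x a b) :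
    ∃ a b, M.IsMid x a b ∧ pos a = pos x - 1 ∧ pos b = pos x + 1 := by
  obtain ⟨a, b, hm⟩ := hx
  rcases h.adjacent hm with h' | h'
  · exact ⟨a, b, hm, h'⟩
  · exact ⟨b, a, M.symm hm, h'.2, h'.1⟩

theorem IsPlacement.mem_convexHull_of_isMid (h : M.IsPlacement pos) {x a b z : J}
    (hm : M.IsMid x a b) (hzx : z ≠ x) (hza : z ≠ a) (hzb : z ≠ b) (ha : pos a = pos x - 1)
    (hb : pos b = pos x + 1) :
    M.parabola pos x ∈
      convexHull ℝ {M.parabola pos a, M.parabola pos b, M.parabola pos z} := by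
  have hxab := h.signedArea_neg (x := a) (y := x) (z := b) (by omega) hm
  rw [signedArea_rotate, signedArea_swap] at hxab
  have not_mid : ∀ {c}, c ≠ b → ¬ M.IsMid x a c := fun hc h' => by
    rcases M.ends_unique hm h' with ⟨-, h''⟩ | ⟨h'', -⟩
    · exact hc h''
    · exact M.ends_ne hm h''
  have not_mid' : ∀ {c}, c ≠ a → ¬ M.IsMid x c b := fun hc h' => by
    rcases M.ends_unique hm h' with ⟨h'', -⟩ | ⟨-, h''⟩
    · exact hc h''
    · exact M.ends_ne hm h''.symm
  rw [signedArea_rotate] at hxab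
  refine mem_convexHull_triple_of_pos ?_ ?_ ?_
  · rw [signedArea_rotate]; linarith
  all_goals
    have hzx' := h.injective.ne hzx
    have hza' := h.injective.ne hza
    have hzb' := h.injective.ne hzb
    rcases lt_or_gt_of_ne hzx' with hlt | hlt
  · rw [← signedArea_rotate]
    exact h.signedArea_pos hlt (by omega) (not_mid' hza)
  · exact h.signedArea_pos (by omega) (by omega) (M.not_mid_end (M.symm hm))
  · rw [signedArea_rotate]
    exact h.signedArea_pos (by omega) (by omega) (M.not_mid_end hm)
  · rw [← signedArea_rotate]
    exact h.signedArea_pos (by omega) hlt (not_mid hzb)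

/-- A line separates the point from `Y`. For a midpoint, either `Y` has no point besides the two
ends, and the line passes above their chord; or an end is missing, and the line passes below the
midpoint. -/
theorem IsPlacement.notMem_convexHull (h : M.IsPlacement pos) {Y : Set J} {x : J}
    (hx : x ∉ M.closure Y) : M.parabola pos x ∉ convexHull ℝ (M.parabola pos '' Y) := by
  have hxY : x ∉ Y := fun h' => hx (Or.inl h')
  by_cases hmid : ∃ a b, M.IsMid x a b
  · obtain ⟨a, b, hm, ha, hb⟩ := h.exists_ends hmid
    by_cases haY : a ∈ Y
    · by_cases hbY : b ∈ Y
      · refine notMem_convexHull_of_gt (2 * pos x) ?_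
        rintro _ ⟨y, hy, rfl⟩
        have hab : y = a ∨ y = b := by
          by_contra! hc
          exact hx (Or.inr ⟨a, b, y, hm, haY, hbY, hy, hc.1, hc.2⟩)
        rw [M.parabola_one_of_mid pos hm]
        rcases hab with rfl | rfl
        · rw [M.parabola_one_of_not_mid pos fun ⟨_, _, h'⟩ => M.not_mid_end hm h']
          simp only [parabola_zero, ha]
          push_cast
          linarith
        · rw [M.parabola_one_of_not_mid pos fun ⟨_, _, h'⟩ => M.not_mid_end (M.symm hm) h']
          simp only [parabola_zero, hb]
          push_cast
          linarith
      -- This is the slope of the chord of the parabola from `pos x` to `pos x + 1`. At offset `d`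
      -- from `pos x` the parabola is `d * (d - 1)` above that chord, which is at least 2 unless `d`
      -- is 0 or 1; the midpoint is only 3/2 above it.
      · refine notMem_convexHull_of_lt (2 * pos x + 1) ?_
        rintro _ ⟨y, hy, rfl⟩
        have h1 : pos y ≠ pos x := h.injective.ne fun h' => hxY (h' ▸ hy)
        have h2 : pos y ≠ pos x + 1 := hb ▸ h.injective.ne fun h' => hbY (h' ▸ hy)
        have h3 : 2 ≤ (pos y - pos x) * (pos y - pos x - 1) := by
          rcases lt_or_gt_of_ne h1 with h4 | h4
          · nlinarith
          · have : pos x + 2 ≤ pos y := by omega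
            nlinarith
        have h3' : (2 : ℝ) ≤ (pos y - pos x) * (pos y - pos x - 1) := by exact_mod_cast h3
        have := M.le_parabola_one pos y
        rw [M.parabola_one_of_mid pos hm]
        simp only [parabola_zero]
        linarith
    · refine notMem_convexHull_of_lt (2 * pos x - 1) ?_
      rintro _ ⟨y, hy, rfl⟩
      have h1 : pos y ≠ pos x := h.injective.ne fun h' => hxY (h' ▸ hy)
      have h2 : pos y ≠ pos x - 1 := ha ▸ h.injective.ne fun h' => haY (h' ▸ hy)
      have h3 : 2 ≤ (pos y - pos x) * (pos y - pos x + 1) := by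
        rcases lt_or_gt_of_ne h1 with h4 | h4
        · have : pos y ≤ pos x - 2 := by omega
          nlinarith
        · nlinarith
      have h3' : (2 : ℝ) ≤ (pos y - pos x) * (pos y - pos x + 1) := by exact_mod_cast h3
      have := M.le_parabola_one pos y
      rw [M.parabola_one_of_mid pos hm]
      simp only [parabola_zero]
      linarith
  · refine notMem_convexHull_of_lt (2 * pos x) ?_
    rintro _ ⟨y, hy, rfl⟩
    have h1 : (pos y : ℝ) - pos x ≠ 0 := by
      rw [sub_ne_zero]
      exact_mod_cast h.injective.ne fun h' : y = x => hxY (h' ▸ hy)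
    have := M.le_parabola_one pos y
    rw [M.parabola_one_of_not_mid pos hmid]
    simp only [parabola_zero]
    nlinarith [sq_pos_of_ne_zero h1]

theorem IsPlacement.isRealization (h : M.IsPlacement pos) :
    IsRealization M.closure (M.parabola pos) := by
  refine ⟨h.inGeneralPosition, fun Y => subset_antisymm ?_ ?_⟩
  · rintro _ ⟨x, hx, rfl⟩
    refine ⟨?_, mem_range_self x⟩
    by_cases hxY : x ∈ Y
    · exact subset_convexHull ℝ _ (mem_image_of_mem _ hxY)
    obtain ⟨a, b, z, hm, ha, hb, hz, hza, hzb⟩ := (M.mem_closure_iff.1 hx).resolve_left hxY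
    have hsub : ∀ {a b}, a ∈ Y → b ∈ Y →
        {M.parabola pos a, M.parabola pos b, M.parabola pos z} ⊆ M.parabola pos '' Y := by
      rintro a b ha hb _ (rfl | rfl | rfl)
      exacts [mem_image_of_mem _ ha, mem_image_of_mem _ hb, mem_image_of_mem _ hz]
    have hzx : z ≠ x := fun h' => hxY (h' ▸ hz)
    rcases h.adjacent hm with ⟨h1, h2⟩ | ⟨h1, h2⟩
    · exact convexHull_mono (hsub ha hb) (h.mem_convexHull_of_isMid hm hzx hza hzb h1 h2)
    · exact convexHull_mono (hsub hb ha)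
        (h.mem_convexHull_of_isMid (M.symm hm) hzx hzb hza h2 h1)
  · rintro _ ⟨hx, x, rfl⟩
    by_contra hc
    exact h.notMem_convexHull (fun h' => hc (mem_image_of_mem _ h')) hx

end Marking

/-! ### Order types as ternary relations -/

/-- The triples of distinct elements with value `1`, as a ternary relation. -/
def IsPositive {J : Type*} (t : Triples J → ℤˣ) (x y z : J) : Prop :=
  ∃ τ : Triples J, τ 0 = x ∧ τ 1 = y ∧ τ 2 = z ∧ t τ = 1

theorem isPositive_apply {J : Type*} (t : Triples J → ℤˣ) (τ : Triples J) :
    IsPositive t (τ 0) (τ 1) (τ 2) ↔ t τ = 1 := by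
  constructor
  · rintro ⟨σ, h0, h1, h2, h⟩
    have : σ = τ := by
      ext i
      fin_cases i
      exacts [h0, h1, h2]
    rwa [← this]
  · exact fun h => ⟨τ, rfl, rfl, rfl, h⟩

theorem orderTypeSetoid_iff_isPositive {J : Type*} {t₁ t₂ : Triples J → ℤˣ} :
    orderTypeSetoid J t₁ t₂ ↔
      ∃ δ : J ≃ J, ∀ x y z, IsPositive t₂ x y z ↔ IsPositive t₁ (δ x) (δ y) (δ z) := by
  refine exists_congr fun δ => ⟨fun h x y z => ⟨?_, ?_⟩, fun h τ => ?_⟩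
  · rintro ⟨τ, rfl, rfl, rfl, hτ⟩
    exact ⟨τ.trans δ.toEmbedding, rfl, rfl, rfl, (h τ).symm.trans hτ⟩
  · rintro ⟨τ, h0, h1, h2, hτ⟩
    refine ⟨τ.trans δ.symm.toEmbedding, ?_, ?_, ?_, ?_⟩
    · simp [h0]
    · simp [h1]
    · simp [h2]
    · rw [h, ← hτ]
      congr 1
      ext i
      simp
  · have h' := h (τ 0) (τ 1) (τ 2)
    rw [isPositive_apply] at h'
    have h'' := isPositive_apply t₁ (τ.trans δ.toEmbedding)
    simp only [Function.Embedding.trans_apply, Equiv.coe_toEmbedding] at h''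
    rw [h''] at h'
    rcases Int.units_eq_one_or (t₂ τ) with h2 | h2 <;>
    rcases Int.units_eq_one_or (t₁ (τ.trans δ.toEmbedding)) with h1 | h1 <;>
    simp_all

theorem isPositive_orderTypeOf {J : Type*} {f : J → Plane} {x y z : J} :
    IsPositive (orderTypeOf f) x y z ↔
      x ≠ y ∧ x ≠ z ∧ y ≠ z ∧ 0 < signedArea (f x) (f y) (f z) := by
  have hsign : ∀ p q r : Plane, orientationSign p q r = 1 ↔ 0 < signedArea p q r := by
    intro p q r
    unfold orientationSign
    split_ifs with h <;> simp [h]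
  constructor
  · rintro ⟨τ, rfl, rfl, rfl, h⟩
    refine ⟨τ.injective.ne (by decide), τ.injective.ne (by decide), τ.injective.ne (by decide), ?_⟩
    exact (hsign _ _ _).1 h
  · rintro ⟨hxy, hxz, hyz, h⟩
    refine ⟨⟨![x, y, z], ?_⟩, rfl, rfl, rfl, (hsign _ _ _).2 h⟩
    intro i j hij
    fin_cases i <;> fin_cases j <;> simp_all

/-! ### From realizations to cyclic orders -/

namespace Marking

variable {J : Type*} (M : Marking J) {P : J → J → J → Prop}

/-- The properties of the anticlockwise triples of a realization. -/
structure IsChirotope (P : J → J → J → Prop) : Prop where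
  ne : ∀ {x y z}, P x y z → x ≠ y ∧ x ≠ z ∧ y ≠ z
  rotate : ∀ {x y z}, P x y z → P y z x
  swap : ∀ {x y z}, x ≠ y → x ≠ z → y ≠ z → (P x z y ↔ ¬ P x y z)
  isMid_of_inside : ∀ {x a b c}, P x a b → P x b c → P x c a →
    M.IsMid x a b ∨ M.IsMid x b c ∨ M.IsMid x c a
  inside_of_isMid : ∀ {x a b c}, M.IsMid x a b → c ≠ x → c ≠ a → c ≠ b → P x a b →
    P x b c ∧ P x c a ∧ P a b c

/-- Lying inside a triangle means lying in the closure of its vertices, and a new point of that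
closure is the midpoint of a side. -/
theorem isChirotope_of_isRealization {f : J → Plane} (hf : IsRealization M.closure f) :
    M.IsChirotope (IsPositive (orderTypeOf f)) := by
  have hne : ∀ {x y z}, x ≠ y → x ≠ z → y ≠ z → signedArea (f x) (f y) (f z) ≠ 0 := by
    intro x y z hxy hxz hyz h
    exact hf.1.2 x y z hxy hxz hyz (collinear_iff_signedArea_eq_zero.2 h)
  have hmem : ∀ {x a b c}, x ∈ M.closure {a, b, c} ↔ f x ∈ convexHull ℝ {f a, f b, f c} := by
    intro x a b c
    have h := hf.2 {a, b, c}
    rw [image_insert_eq, image_pair] at h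
    constructor
    · intro hx
      have : f x ∈ f '' M.closure {a, b, c} := mem_image_of_mem f hx
      rw [h] at this
      exact this.1
    · intro hx
      have : f x ∈ f '' M.closure {a, b, c} := by
        rw [h]
        exact ⟨hx, mem_range_self x⟩
      exact hf.1.1.mem_set_image.1 this
  constructor
  · simp only [isPositive_orderTypeOf]
    tauto
  · simp only [isPositive_orderTypeOf]
    rintro x y z ⟨h1, h2, h3, h⟩
    exact ⟨h3, h1.symm, h2.symm, signedArea_rotate _ _ _ ▸ h⟩
  · simp only [isPositive_orderTypeOf]
    intro x y z h1 h2 h3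
    have := hne h1 h2 h3
    rw [signedArea_swap]
    constructor
    · rintro ⟨-, -, -, h⟩ ⟨-, -, -, h'⟩
      linarith
    · intro h
      refine ⟨h2, h1, h3.symm, ?_⟩
      by_contra hc
      exact h ⟨h1, h2, h3, lt_of_le_of_ne (by linarith) this.symm⟩
  · simp only [isPositive_orderTypeOf]
    rintro x a b c ⟨h1, h2, h3, h⟩ ⟨-, h4, h5, h'⟩ ⟨-, -, h6, h''⟩
    have := hmem.2 (mem_convexHull_triple_of_pos h h' h'')
    rcases M.mem_closure_iff.1 this with hx | ⟨p, q, z, hm, hp, hq, -⟩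
    · simp only [mem_insert_iff, mem_singleton_iff] at hx
      tauto
    · have hpq := M.ends_ne hm
      have hm' := M.symm hm
      rcases hp with rfl | rfl | rfl <;> rcases hq with rfl | rfl | rfl <;> tauto
  · simp only [isPositive_orderTypeOf]
    rintro x a b c hm hcx hca hcb ⟨h1, h2, h3, h⟩
    have hx : x ∈ M.closure {a, b, c} :=
      Or.inr ⟨a, b, c, hm, by simp, by simp, by simp, hca, hcb⟩
    obtain ⟨g1, g2, g3⟩ := signedArea_pos_of_mem_convexHull (hmem.1 hx) h
      (hne h2 hcx.symm hcb.symm) (hne hcx.symm h1 hca)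
    exact ⟨⟨h2, hcx.symm, hcb.symm, g1⟩, ⟨hcx.symm, h1, hca, g2⟩, ⟨h3, hca.symm, hcb.symm, g3⟩⟩

/-- `x, y, z` are, in some order, a midpoint and the ends of its edge. -/
def IsMarked (x y z : J) : Prop :=
  M.IsMid x y z ∨ M.IsMid y z x ∨ M.IsMid z x y

/-- The orientation with the signs of the marked triples reversed. -/
def Cyc (P : J → J → J → Prop) (x y z : J) : Prop :=
  x ≠ y ∧ x ≠ z ∧ y ≠ z ∧ (P x y z ↔ ¬ M.IsMarked x y z)

end Marking

/-- A strict total cyclic order. -/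
structure IsCyclicOrder {J : Type*} (C : J → J → J → Prop) : Prop where
  ne : ∀ {x y z}, C x y z → x ≠ y ∧ x ≠ z ∧ y ≠ z
  rotate : ∀ {x y z}, C x y z → C y z x
  total : ∀ {x y z}, x ≠ y → x ≠ z → y ≠ z → C x y z ∨ C x z y
  asymm : ∀ {x y z}, C x y z → ¬ C x z y
  trans : ∀ {x a b c}, C x a b → C x b c → C x a c

namespace Marking

variable {J : Type*} {M : Marking J} {P : J → J → J → Prop}

theorem isMarked_rotate {x y z : J} : M.IsMarked x y z ↔ M.IsMarked y z x := by
  unfold IsMarked; tauto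

theorem isMarked_swap {x y z : J} : M.IsMarked x y z ↔ M.IsMarked x z y := by
  have h := @M.symm
  unfold IsMarked
  constructor <;> rintro (h' | h' | h') <;> have := h h' <;> tauto

/-- Two marked triples share at most one element. -/
theorem IsMarked.eq {x y z w : J} (h : M.IsMarked x y z) (h' : M.IsMarked x y w) : z = w := by
  have h1 := @M.symm
  have h2 := @M.ends_unique
  have h3 := @M.not_mid_end
  have h4 := @M.mid_unique
  have h5 := @M.ends_ne
  rcases h with h | h | h <;> rcases h' with h' | h' | h' <;> grind

/-- Only transitivity needs an argument. Its failure gives a point surrounded by three others with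
respect to `Cyc`. If no sign involved was reversed, the point lies inside their triangle and is the
midpoint of a side, so a triple was marked after all. -/
theorem IsChirotope.isCyclicOrder (hP : M.IsChirotope P) : IsCyclicOrder (M.Cyc P) := by
  have rot : ∀ {x y z}, M.Cyc P x y z → M.Cyc P y z x := by
    rintro x y z ⟨h1, h2, h3, h⟩
    refine ⟨h3, h1.symm, h2.symm, ?_⟩
    rw [← isMarked_rotate, ← h]
    exact ⟨fun h => hP.rotate (hP.rotate h), hP.rotate⟩
  have swap : ∀ {x y z}, x ≠ y → x ≠ z → y ≠ z → (M.Cyc P x z y ↔ ¬ M.Cyc P x y z) := by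
    intro x y z h1 h2 h3
    have := hP.swap h1 h2 h3
    have := M.isMarked_swap (x := x) (y := y) (z := z)
    have := h3.symm
    unfold Cyc
    tauto
  -- no point is surrounded by three others
  have unmarked : ∀ {x a b c}, M.Cyc P x a b → M.Cyc P x b c → M.Cyc P x c a →
      ¬ M.IsMarked x a b := by
    rintro x a b c hab hbc hca hm
    -- The other two triples share two elements with the marked one, so only the sign of `x, a, b`
    -- was reversed. In each of the three roles of the midpoint, `inside_of_isMid` with third point
    -- `c` contradicts one of the unreversed signs.
    have hbc' : ¬ M.IsMarked x b c := fun h =>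
      hca.2.2.1 (IsMarked.eq h (isMarked_swap.1 hm))
    have hca' : ¬ M.IsMarked x c a := fun h =>
      hbc.2.2.1 (IsMarked.eq hm (isMarked_swap.1 h))
    have p2 : P x b c := hbc.2.2.2.2 hbc'
    have p3 : P x c a := hca.2.2.2.2 hca'
    have p1 : P x b a :=
      (hP.swap hab.1 hab.2.1 hab.2.2.1).2 fun h => hab.2.2.2.1 h hm
    have q2 : ¬ P x c b := (hP.swap hbc.2.1 hbc.1 hbc.2.2.1.symm).1 p2
    have q3 : ¬ P x a c := (hP.swap hca.2.1 hca.1 hca.2.2.1.symm).1 p3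
    rcases hm with hm | hm | hm
    · exact q3 (hP.inside_of_isMid (M.symm hm) hbc.2.1.symm hbc.2.2.1.symm hca.2.2.1 p1).1
    · have := hP.inside_of_isMid (M.symm hm) hca.2.2.1 hbc.2.1.symm hbc.2.2.1.symm
        (hP.rotate (hP.rotate p1))
      exact q3 (hP.rotate (hP.rotate this.2.1))
    · have := hP.inside_of_isMid (M.symm hm) hbc.2.2.1.symm hca.2.2.1 hbc.2.1.symm
        (hP.rotate p1)
      exact q2 (hP.rotate this.1)
  constructor
  · exact fun h => ⟨h.1, h.2.1, h.2.2.1⟩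
  · exact rot
  · intro x y z h1 h2 h3
    rw [swap h1 h2 h3]
    exact em _
  · intro x y z h
    rw [swap h.1 h.2.1 h.2.2.1]
    exact not_not_intro h
  · intro x a b c hab hbc
    have hac : a ≠ c := by
      rintro rfl
      exact (swap hab.1 hab.2.1 hab.2.2.1).1 hbc hab
    by_contra hc
    have hca := (swap hab.1 hbc.2.1 hac).2 hc
    have m1 := unmarked hab hbc hca
    have m2 := unmarked hbc hca hab
    have m3 := unmarked hca hab hbc
    have := hP.isMid_of_inside (hab.2.2.2.2 m1) (hbc.2.2.2.2 m2) (hca.2.2.2.2 m3)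
    unfold IsMarked at m1 m2 m3
    tauto

end Marking

/-! ### Cutting finite cyclic orders -/

namespace IsCyclicOrder

variable {J : Type*} {C : J → J → J → Prop} {o : J}

/-- The linear order with least element `o` obtained by cutting a cyclic order at `o`. -/
def Precedes (C : J → J → J → Prop) (o x y : J) : Prop :=
  (x = o ∧ y ≠ o) ∨ C o x y

/-- The number of elements before `x` when a cyclic order is cut at `o`. -/
noncomputable def rank (C : J → J → J → Prop) (o x : J) : ℕ :=
  {y | Precedes C o y x}.ncard

/-- `x` and `y` are next to each other. -/
def Adjacent (C : J → J → J → Prop) (x y : J) : Prop :=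
  x ≠ y ∧ ((∀ z, ¬ C x z y) ∨ ∀ z, ¬ C y z x)

theorem precedes_irrefl (hC : IsCyclicOrder C) (x : J) : ¬ Precedes C o x x := by
  rintro (h | h)
  · exact h.2 h.1
  · exact (hC.ne h).2.2 rfl

theorem precedes_trans (hC : IsCyclicOrder C) {x y z : J} (h : Precedes C o x y) (h' : Precedes C o y z) :
    Precedes C o x z := by
  rcases h with ⟨rfl, h⟩ | h <;> rcases h' with ⟨rfl, h'⟩ | h'
  · exact (h rfl).elim
  · exact Or.inl ⟨rfl, (hC.ne h').2.1.symm⟩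
  · exact ((hC.ne h).2.1 rfl).elim
  · exact Or.inr (hC.trans h h')

theorem precedes_total (hC : IsCyclicOrder C) {x y : J} (h : x ≠ y) : Precedes C o x y ∨ Precedes C o y x := by
  by_cases hx : x = o
  · exact Or.inl (Or.inl ⟨hx, fun hy => h (hx.trans hy.symm)⟩)
  by_cases hy : y = o
  · exact Or.inr (Or.inl ⟨hy, hx⟩)
  exact (hC.total (Ne.symm hx) (Ne.symm hy) h).imp Or.inr Or.inr

/-- No information is lost in cutting: the cyclic triples are the rotations of the increasing ones.
Hence a bijection preserving ranks preserves the cyclic order. -/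
theorem iff_precedes (hC : IsCyclicOrder C) {x y z : J} : C x y z ↔
    (Precedes C o x y ∧ Precedes C o y z) ∨ (Precedes C o y z ∧ Precedes C o z x) ∨
      (Precedes C o z x ∧ Precedes C o x y) := by
  have key : ∀ {x y z}, Precedes C o x y → Precedes C o y z → C x y z := by
    rintro x y z h h'
    rcases h with ⟨rfl, h⟩ | h <;> rcases h' with ⟨rfl, h'⟩ | h'
    · exact (h rfl).elim
    · exact h'
    · exact ((hC.ne h).2.1 rfl).elim
    -- Transitivity is applied at base point `y`, to the triples `y, z, o` and `y, o, x`.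
    · exact hC.rotate (hC.rotate (hC.trans (hC.rotate h') (hC.rotate (hC.rotate h))))
  constructor
  · intro h
    obtain ⟨h1, h2, h3⟩ := hC.ne h
    by_contra! hc
    have hxzy : (Precedes C o x z ∧ Precedes C o z y) ∨ (Precedes C o z y ∧ Precedes C o y x) ∨
        (Precedes C o y x ∧ Precedes C o x z) := by
      have t1 := hC.precedes_total (o := o) h1
      have t2 := hC.precedes_total (o := o) h2
      have t3 := hC.precedes_total (o := o) h3
      tauto
    refine hC.asymm h ?_
    rcases hxzy with ⟨h1, h2⟩ | ⟨h1, h2⟩ | ⟨h1, h2⟩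
    · exact key h1 h2
    · exact hC.rotate (hC.rotate (key h1 h2))
    · exact hC.rotate (key h1 h2)
  · rintro (⟨h1, h2⟩ | ⟨h1, h2⟩ | ⟨h1, h2⟩)
    · exact key h1 h2
    · exact hC.rotate (hC.rotate (key h1 h2))
    · exact hC.rotate (key h1 h2)

theorem rank_lt_rank [Finite J] (hC : IsCyclicOrder C) {x y : J} (h : Precedes C o x y) : rank C o x < rank C o y := by
  refine ncard_lt_ncard ⟨fun z hz => hC.precedes_trans hz h, fun hsub => ?_⟩
  exact hC.precedes_irrefl x (hsub h)

theorem rank_lt_rank_iff [Finite J] (hC : IsCyclicOrder C) {x y : J} : rank C o x < rank C o y ↔ Precedes C o x y := by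
  refine ⟨fun h => ?_, hC.rank_lt_rank⟩
  by_contra hc
  rcases eq_or_ne x y with rfl | hne
  · exact lt_irrefl _ h
  · exact lt_asymm h (hC.rank_lt_rank ((hC.precedes_total hne).resolve_left hc))

theorem rank_injective [Finite J] (hC : IsCyclicOrder C) : Function.Injective (rank C o) := by
  intro x y h
  by_contra hne
  rcases hC.precedes_total (o := o) hne with h' | h'
  · exact (hC.rank_lt_rank h').ne h
  · exact (hC.rank_lt_rank h').ne' h

theorem rank_lt_card [Finite J] (hC : IsCyclicOrder C) (x : J) : rank C o x < Nat.card J := by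
  rw [rank, ← ncard_univ]
  refine ncard_lt_ncard ⟨subset_univ _, fun h => hC.precedes_irrefl x (h (mem_univ x))⟩

/-- Finite cyclic orders on the same set are isomorphic, with prescribed base points. -/
theorem exists_equiv [Finite J] (hC : IsCyclicOrder C) {C' : J → J → J → Prop} (hC' : IsCyclicOrder C') (o : J) :
    ∃ δ : J ≃ J, (∀ x, rank C' o (δ x) = rank C o x) ∧
      ∀ x y z, C x y z ↔ C' (δ x) (δ y) (δ z) := by
  have bij : ∀ {D : J → J → J → Prop} (hD : IsCyclicOrder D),
      Function.Bijective fun x => (⟨rank D o x, hD.rank_lt_card x⟩ : Fin (Nat.card J)) :=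
    fun hD => Function.Injective.bijective_of_nat_card_le
      (fun x y h => hD.rank_injective (Fin.mk.inj_iff.1 h)) (by simp)
  let δ := (Equiv.ofBijective _ (bij hC)).trans (Equiv.ofBijective _ (bij hC')).symm
  have hδ : ∀ x, rank C' o (δ x) = rank C o x := by
    intro x
    have := (Equiv.ofBijective _ (bij hC')).apply_symm_apply (Equiv.ofBijective _ (bij hC) x)
    exact Fin.mk.inj_iff.1 this
  refine ⟨δ, hδ, fun x y z => ?_⟩
  rw [hC.iff_precedes (o := o), hC'.iff_precedes (o := o)]
  simp only [← hC.rank_lt_rank_iff, ← hC'.rank_lt_rank_iff, hδ]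

end IsCyclicOrder

namespace IsCyclicOrder

variable {J : Type*} {C : J → J → J → Prop}

theorem Adjacent.symm {x y : J} (h : Adjacent C x y) : Adjacent C y x :=
  ⟨h.1.symm, h.2.symm⟩

/-- An element of a cyclic order has at most two neighbours. -/
theorem eq_or_eq_of_adjacent (hC : IsCyclicOrder C) {o x y z : J} (hx : Adjacent C o x)
    (hy : Adjacent C o y) (hxy : x ≠ y) (hz : Adjacent C o z) : z = x ∨ z = y := by
  have succ : ∀ {x y}, o ≠ x → o ≠ y → (∀ z, ¬ C o z x) → (∀ z, ¬ C o z y) → x = y := by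
    intro x y hx hy h h'
    by_contra hne
    exact (hC.total hx hy hne).elim (h' x) (h y)
  have pred : ∀ {x y}, o ≠ x → o ≠ y → (∀ z, ¬ C x z o) → (∀ z, ¬ C y z o) → x = y := by
    intro x y hx hy h h'
    by_contra hne
    exact (hC.total hx hy hne).elim (fun h'' => h y (hC.rotate h''))
      (fun h'' => h' x (hC.rotate h''))
  obtain ⟨hx0, hx⟩ := hx
  obtain ⟨hy0, hy⟩ := hy
  obtain ⟨hz0, hz⟩ := hz
  rcases hx with hx | hx <;> rcases hy with hy | hy
  · exact (hxy (succ hx0 hy0 hx hy)).elim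
  · exact hz.imp (fun hz => succ hz0 hx0 hz hx) (fun hz => pred hz0 hy0 hz hy)
  · exact hz.symm.imp (fun hz => pred hz0 hx0 hz hx) (fun hz => succ hz0 hy0 hz hy)
  · exact (hxy (pred hx0 hy0 hx hy)).elim

end IsCyclicOrder

/-! ### Order types and the positions of midpoints -/

open IsCyclicOrder

namespace Marking

variable {J : Type*} {M : Marking J} {P P' : J → J → J → Prop} {o : J}

/-- The midpoints of the edges that do not contain `o`. -/
def midsAwayFrom (M : Marking J) (o : J) : Set J :=
  {x | (∃ a b, M.IsMid x a b) ∧ ¬ ∃ b, M.IsMid x o b}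

/-- `o` is the only common end of two edges. -/
def IsHub (M : Marking J) (o : J) : Prop :=
  ∀ o', (∃ u v a b, u ≠ v ∧ M.IsMid u o' a ∧ M.IsMid v o' b) ↔ o' = o

/-- The elements that are not part of a marked triple. -/
def IsFree (M : Marking J) (x : J) : Prop :=
  ∀ a b, ¬ M.IsMid x a b ∧ ¬ M.IsMid a x b

/-- The midpoint lies in the triangle `a, b, z`, which fixes the signs of the triples with `z`;
these share two elements with a marked triple and so are not reversed. Thus no `z` separates the
midpoint from its ends. -/
theorem IsChirotope.cyc_between (hP : M.IsChirotope P) {x a b z : J} (hm : M.IsMid x a b)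
    (hC : M.Cyc P a x b) (hzx : z ≠ x) (hza : z ≠ a) (hzb : z ≠ b) :
    M.Cyc P a x z ∧ M.Cyc P x b z := by
  obtain ⟨h1, h2, h3, h⟩ := hC
  have hmk : M.IsMarked a x b := Or.inr (Or.inl (M.symm hm))
  have hn : ¬ P a x b := fun h' => h.1 h' hmk
  have hp : P x a b := hP.rotate (hP.rotate ((hP.swap h1 h2 h3).2 hn))
  obtain ⟨p1, p2, p3⟩ := hP.inside_of_isMid hm hzx hza hzb hp
  have m1 : ¬ M.IsMarked a x z := fun h' => hzb (IsMarked.eq h' hmk)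
  have m2 : ¬ M.IsMarked x b z := fun h' => hza (IsMarked.eq h' (isMarked_rotate.1 hmk))
  exact ⟨⟨h1, hza.symm, hzx.symm, ⟨fun _ => m1, fun _ => hP.rotate (hP.rotate p2)⟩⟩,
    ⟨h3, hzx.symm, hzb.symm, ⟨fun _ => m2, fun _ => p1⟩⟩⟩

theorem IsChirotope.adjacent_iff (hP : M.IsChirotope P) {x a b y : J} (hm : M.IsMid x a b) :
    Adjacent (M.Cyc P) x y ↔ y = a ∨ y = b := by
  have hC := hP.isCyclicOrder
  wlog hab : M.Cyc P a x b generalizing a b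
  · rw [or_comm]
    refine this (M.symm hm) ?_
    have := (hC.total (M.mid_ne_left hm).symm (M.ends_ne hm) (M.mid_ne_right hm)).resolve_left hab
    exact hC.rotate this
  have ha : Adjacent (M.Cyc P) x a := by
    refine ⟨M.mid_ne_left hm, Or.inr fun z hz => ?_⟩
    obtain ⟨h1, h2, h3⟩ := hC.ne hz
    rcases eq_or_ne z b with rfl | hzb
    · exact hC.asymm hab hz
    · exact hC.asymm (hP.cyc_between hm hab h3 h1.symm hzb).1 hz
  have hb : Adjacent (M.Cyc P) x b := by
    refine ⟨M.mid_ne_right hm, Or.inl fun z hz => ?_⟩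
    obtain ⟨h1, h2, h3⟩ := hC.ne hz
    rcases eq_or_ne z a with rfl | hza
    · exact hC.asymm (hC.rotate hab) hz
    · exact hC.asymm (hP.cyc_between hm hab h1.symm hza h3).2 hz
  constructor
  · exact hC.eq_or_eq_of_adjacent ha hb (M.ends_ne hm)
  · rintro (rfl | rfl)
    exacts [ha, hb]

/-- The midpoints of two edges at the hub already occupy both neighbouring places. -/
theorem IsChirotope.exists_isMid_hub_iff (hP : M.IsChirotope P) (ho : M.IsHub o) {x : J} :
    (∃ b, M.IsMid x o b) ↔ Adjacent (M.Cyc P) o x := by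
  have hadj : ∀ {u a}, M.IsMid u o a → Adjacent (M.Cyc P) o u := fun h =>
    ((hP.adjacent_iff h).2 (Or.inl rfl)).symm
  constructor
  · rintro ⟨b, h⟩
    exact hadj h
  · intro h
    obtain ⟨u, v, a, b, huv, hu, hv⟩ := (ho o).2 rfl
    rcases hP.isCyclicOrder.eq_or_eq_of_adjacent (hadj hu) (hadj hv) huv h with rfl | rfl
    exacts [⟨a, hu⟩, ⟨b, hv⟩]

/-- The ranks of the midpoints away from the hub. -/
noncomputable def midRanks (M : Marking J) (o : J) (P : J → J → J → Prop) : Set ℕ :=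
  rank (M.Cyc P) o '' M.midsAwayFrom o

/-- A realization is determined, up to equivalence, by the ranks of the midpoints. -/
theorem IsChirotope.exists_equiv [Finite J] (hP : M.IsChirotope P) (hP' : M.IsChirotope P')
    (ho : M.IsHub o) (h : M.midRanks o P = M.midRanks o P') :
    ∃ δ : J ≃ J, ∀ x y z, P x y z ↔ P' (δ x) (δ y) (δ z) := by
  have hC := hP.isCyclicOrder
  have hC' := hP'.isCyclicOrder
  obtain ⟨δ, hrank, hδ⟩ := hC.exists_equiv hC' o
  -- The base point is the only element of least rank.
  have hδo : δ o = o := by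
    by_contra hne
    have h1 := hC'.rank_lt_rank (o := o) (Or.inl ⟨rfl, hne⟩)
    rw [hrank] at h1
    have h2 : Precedes (M.Cyc P) o o (δ.symm o) := by
      refine Or.inl ⟨rfl, fun h' => hne ?_⟩
      rw [← h', Equiv.apply_symm_apply, h']
    have h3 := hC.rank_lt_rank h2
    rw [← hrank (δ.symm o), Equiv.apply_symm_apply] at h3
    exact lt_asymm h1 h3
  have hadj : ∀ x y, Adjacent (M.Cyc P) x y ↔ Adjacent (M.Cyc P') (δ x) (δ y) := by
    exact fun x y => and_congr δ.injective.ne_iff.symm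
      (or_congr (δ.forall_congr fun z => not_congr (hδ x z y))
        (δ.forall_congr fun z => not_congr (hδ y z x)))
  have haway : ∀ x, x ∈ M.midsAwayFrom o ↔ δ x ∈ M.midsAwayFrom o := by
    intro x
    constructor
    · intro hx
      have : rank (M.Cyc P) o x ∈ M.midRanks o P' := h ▸ mem_image_of_mem _ hx
      obtain ⟨y, hy, hxy⟩ := this
      rw [← hrank] at hxy
      rwa [← hC'.rank_injective hxy]
    · intro hx
      have : rank (M.Cyc P') o (δ x) ∈ M.midRanks o P := h ▸ mem_image_of_mem _ hx
      obtain ⟨y, hy, hxy⟩ := this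
      rw [hrank] at hxy
      rwa [← hC.rank_injective hxy]
  have hhub : ∀ x, (∃ b, M.IsMid x o b) ↔ ∃ b, M.IsMid (δ x) o b := by
    intro x
    rw [hP.exists_isMid_hub_iff ho, hP'.exists_isMid_hub_iff ho, hadj, hδo]
  -- Midpoints away from the hub are recognized by their ranks, the others as neighbours of the hub.
  have hmid : ∀ x, (∃ a b, M.IsMid x a b) ↔ ∃ a b, M.IsMid (δ x) a b := by
    have split : ∀ x, (∃ a b, M.IsMid x a b) ↔
        x ∈ M.midsAwayFrom o ∨ ∃ b, M.IsMid x o b := by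
      intro x
      by_cases hx : ∃ b, M.IsMid x o b
      · exact ⟨fun _ => Or.inr hx, fun _ => ⟨o, hx⟩⟩
      · exact ⟨fun h => Or.inl ⟨h, hx⟩, fun h => (h.resolve_right hx).1⟩
    intro x
    rw [split, split, haway, hhub]
  -- The ends of an edge are the neighbours of its midpoint, so the whole marking is preserved, and
  -- `P` is recovered from `Cyc` by reversing the marked signs again.
  have hends : ∀ {x a b}, M.IsMid x a b → M.IsMid (δ x) (δ a) (δ b) := by
    intro x a b hm
    obtain ⟨c, d, hm'⟩ := (hmid x).1 ⟨a, b, hm⟩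
    have ha := (hP'.adjacent_iff hm').1 ((hadj x a).1 ((hP.adjacent_iff hm).2 (Or.inl rfl)))
    have hb := (hP'.adjacent_iff hm').1 ((hadj x b).1 ((hP.adjacent_iff hm).2 (Or.inr rfl)))
    have hab : δ a ≠ δ b := δ.injective.ne (M.ends_ne hm)
    rcases ha with ha | ha <;> rcases hb with hb | hb
    · exact (hab (ha.trans hb.symm)).elim
    · rwa [ha, hb]
    · rw [ha, hb]
      exact M.symm hm'
    · exact (hab (ha.trans hb.symm)).elim
  have hIsMid : ∀ x a b, M.IsMid x a b ↔ M.IsMid (δ x) (δ a) (δ b) := by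
    refine fun x a b => ⟨hends, fun hm => ?_⟩
    obtain ⟨c, d, hm'⟩ := (hmid x).2 ⟨_, _, hm⟩
    rcases M.ends_unique (hends hm') hm with ⟨h1, h2⟩ | ⟨h1, h2⟩
    · rwa [δ.injective h1, δ.injective h2]
    · rw [δ.injective h1, δ.injective h2]
      exact M.symm hm'
  refine ⟨δ, fun x y z => ?_⟩
  have hMk : M.IsMarked x y z ↔ M.IsMarked (δ x) (δ y) (δ z) := by
    simp only [IsMarked, ← hIsMid]
  have hxyz := hδ x y z
  have n1 := hP.ne (x := x) (y := y) (z := z)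
  have n2 := hP'.ne (x := δ x) (y := δ y) (z := δ z)
  simp only [Cyc, ← hMk, ne_eq, δ.apply_eq_iff_eq] at hxyz n2
  tauto

/-- Isomorphisms of chirotopes preserve the marking. -/
theorem IsChirotope.isMid_iff (hP : M.IsChirotope P) (hP' : M.IsChirotope P')
    (hcard : ∀ a b c d : J, ∃ z, z ≠ a ∧ z ≠ b ∧ z ≠ c ∧ z ≠ d) {δ : J ≃ J}
    (h : ∀ x y z, P x y z ↔ P' (δ x) (δ y) (δ z)) (x a b : J) :
    M.IsMid x a b ↔ M.IsMid (δ x) (δ a) (δ b) := by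
  -- The marking is visible in the orientation: `x` lies in the triangle `a, b, c` for every other
  -- `c`. Conversely, if `x` were not the midpoint of `a, b`, two choices of `c` would give it two
  -- different edges.
  have char : ∀ {Q : J → J → J → Prop}, M.IsChirotope Q → ∀ {x a b}, M.IsMid x a b ↔
      a ≠ b ∧ x ≠ a ∧ x ≠ b ∧ ∀ c, c ≠ x → c ≠ a → c ≠ b →
        (Q x a b ∧ Q x b c ∧ Q x c a) ∨ (Q x b a ∧ Q x a c ∧ Q x c b) := by
    intro Q hQ x a b
    constructor
    · intro hm
      refine ⟨M.ends_ne hm, M.mid_ne_left hm, M.mid_ne_right hm, fun c hx ha hb => ?_⟩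
      by_cases hq : Q x a b
      · have := hQ.inside_of_isMid hm hx ha hb hq
        exact Or.inl ⟨hq, this.1, this.2.1⟩
      · have hq' := (hQ.swap (M.mid_ne_left hm) (M.mid_ne_right hm) (M.ends_ne hm)).2 hq
        have := hQ.inside_of_isMid (M.symm hm) hx hb ha hq'
        exact Or.inr ⟨hq', this.1, this.2.1⟩
    · rintro ⟨hab, hxa, hxb, hc⟩
      have key : ∀ c, c ≠ x → c ≠ a → c ≠ b →
          M.IsMid x a b ∨ M.IsMid x b c ∨ M.IsMid x a c := by
        intro c h1 h2 h3
        have hs := @M.symm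
        rcases hc c h1 h2 h3 with ⟨q1, q2, q3⟩ | ⟨q1, q2, q3⟩
        · rcases hQ.isMid_of_inside q1 q2 q3 with h | h | h
          exacts [Or.inl h, Or.inr (Or.inl h), Or.inr (Or.inr (hs h))]
        · rcases hQ.isMid_of_inside q1 q2 q3 with h | h | h
          exacts [Or.inl (hs h), Or.inr (Or.inr h), Or.inr (Or.inl (hs h))]
      obtain ⟨c, c1, c2, c3, -⟩ := hcard x a b b
      obtain ⟨d, d1, d2, d3, d4⟩ := hcard x a b c
      have hu := @M.ends_unique
      rcases key c c1 c2 c3 with h | h | h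
      · exact h
      all_goals
        rcases key d d1 d2 d3 with h' | h' | h'
        · exact h'
        all_goals
          rcases hu h h' with ⟨e1, e2⟩ | ⟨e1, e2⟩ <;> tauto
  rw [char hP, char hP']
  refine and_congr δ.injective.ne_iff.symm (and_congr δ.injective.ne_iff.symm
    (and_congr δ.injective.ne_iff.symm (δ.forall_congr fun c => ?_)))
  simp only [h, δ.injective.ne_iff]

/-- The numbers of free elements before the midpoints away from the hub. -/
noncomputable def freeRanks (M : Marking J) (o : J) (P : J → J → J → Prop) : Set ℕ :=
  (fun u => {x | M.IsFree x ∧ M.Cyc P o x u}.ncard) '' M.midsAwayFrom o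

/-- The hub, the free elements and the midpoints away from the hub are all defined by the marking,
which isomorphisms preserve. -/
theorem IsChirotope.freeRanks_eq (hP : M.IsChirotope P) (hP' : M.IsChirotope P')
    (hcard : ∀ a b c d : J, ∃ z, z ≠ a ∧ z ≠ b ∧ z ≠ c ∧ z ≠ d) (ho : M.IsHub o) {δ : J ≃ J}
    (h : ∀ x y z, P x y z ↔ P' (δ x) (δ y) (δ z)) : M.freeRanks o P = M.freeRanks o P' := by
  have hmid := hP.isMid_iff hP' hcard h
  have hδo : δ o = o := by
    obtain ⟨u, v, a, b, huv, hu, hv⟩ := (ho o).2 rfl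
    exact (ho _).1 ⟨δ u, δ v, δ a, δ b, δ.injective.ne huv, (hmid _ _ _).1 hu, (hmid _ _ _).1 hv⟩
  have hfree : ∀ x, M.IsFree x ↔ M.IsFree (δ x) := by
    exact fun x => δ.forall_congr fun a => δ.forall_congr fun b =>
      and_congr (not_congr (hmid _ _ _)) (not_congr (hmid _ _ _))
  have haway : ∀ x, x ∈ M.midsAwayFrom o ↔ δ x ∈ M.midsAwayFrom o := by
    exact fun x => and_congr (δ.exists_congr fun a => δ.exists_congr fun b => hmid _ _ _)
      (not_congr (δ.exists_congr fun b => by rw [hmid, hδo]))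
  have hcyc : ∀ x u, M.Cyc P o x u ↔ M.Cyc P' o (δ x) (δ u) := by
    intro x u
    have h1 := h o x u
    have h2 : M.IsMarked o x u ↔ M.IsMarked (δ o) (δ x) (δ u) :=
      or_congr (hmid _ _ _) (or_congr (hmid _ _ _) (hmid _ _ _))
    have h3 : ∀ y, δ o ≠ δ y ↔ o ≠ y := fun y => δ.injective.ne_iff
    rw [hδo] at h1 h2 h3
    simp only [Cyc, h1, h2, h3, δ.injective.ne_iff]
  have hnum : ∀ u, {x | M.IsFree x ∧ M.Cyc P o x u}.ncard =
      {x | M.IsFree x ∧ M.Cyc P' o x (δ u)}.ncard := by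
    intro u
    rw [← ncard_image_of_injective _ δ.injective]
    congr 1
    ext x
    rw [δ.image_eq_preimage_symm]
    simp only [mem_preimage, mem_ofPred_eq, hfree (δ.symm x), hcyc (δ.symm x),
      δ.apply_symm_apply]
  ext m
  simp only [freeRanks, mem_image, hnum]
  constructor
  · rintro ⟨u, hu, rfl⟩
    exact ⟨δ u, (haway u).1 hu, rfl⟩
  · rintro ⟨u, hu, rfl⟩
    refine ⟨δ.symm u, (haway _).2 (by rwa [δ.apply_symm_apply]), by rw [δ.apply_symm_apply]⟩

end Marking

/-! ### The series of geometries and the two bounds -/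

open IsCyclicOrder

/-- Two edges with the common end `hub`, `k` further edges, all with a midpoint, and `p` free
points. -/
inductive ChainPoint (k p : ℕ) : Type
  | hub
  | hubMid (s : Bool)
  | hubEnd (s : Bool)
  | mid (j : Fin k)
  | tip (j : Fin k) (s : Bool)
  | free (i : Fin p)

/-- The marking of `ChainPoint k p`. -/
inductive ChainPoint.IsMid {k p : ℕ} : ChainPoint k p → ChainPoint k p → ChainPoint k p → Prop
  | hub_left (s : Bool) : IsMid (hubMid s) hub (hubEnd s)
  | hub_right (s : Bool) : IsMid (hubMid s) (hubEnd s) hub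
  | tip_left (j : Fin k) : IsMid (mid j) (tip j false) (tip j true)
  | tip_right (j : Fin k) : IsMid (mid j) (tip j true) (tip j false)

namespace ChainPoint

variable {k p : ℕ}

/-- `ChainPoint k p` as a disjoint union. -/
def equivSum (k p : ℕ) :
    ChainPoint k p ≃ Unit ⊕ Bool ⊕ Bool ⊕ Fin k ⊕ (Fin k × Bool) ⊕ Fin p where
  toFun
    | hub => .inl ()
    | hubMid s => .inr (.inl s)
    | hubEnd s => .inr (.inr (.inl s))
    | mid j => .inr (.inr (.inr (.inl j)))
    | tip j s => .inr (.inr (.inr (.inr (.inl (j, s)))))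
    | free i => .inr (.inr (.inr (.inr (.inr i))))
  invFun
    | .inl _ => hub
    | .inr (.inl s) => hubMid s
    | .inr (.inr (.inl s)) => hubEnd s
    | .inr (.inr (.inr (.inl j))) => mid j
    | .inr (.inr (.inr (.inr (.inl x)))) => tip x.1 x.2
    | .inr (.inr (.inr (.inr (.inr i)))) => free i
  left_inv x := by cases x <;> rfl
  right_inv x := by rcases x with _ | _ | _ | _ | _ | _ <;> rfl

instance : Finite (ChainPoint k p) := Finite.of_equiv _ (equivSum k p).symm

theorem natCard (k p : ℕ) : Nat.card (ChainPoint k p) = p + (3 * k + 5) := by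
  rw [Nat.card_congr (equivSum k p)]
  simp
  ring

/-- The marking of `ChainPoint k p`, bundled. -/
def marking (k p : ℕ) : Marking (ChainPoint k p) where
  IsMid := IsMid
  symm h := by cases h <;> constructor
  ends_ne h := by cases h <;> simp
  not_mid_end h h' := by cases h <;> cases h'
  ends_unique h h' := by cases h <;> cases h' <;> simp
  mid_unique h h' := by cases h <;> cases h' <;> rfl

theorem exists_ne (a b c d : ChainPoint k p) : ∃ z, z ≠ a ∧ z ≠ b ∧ z ≠ c ∧ z ≠ d := by
  classical
  by_contra! hc
  have hsub : (Set.univ : Set (ChainPoint k p)) ⊆ (({a, b, c, d} : Finset _) : Set _) := by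
    intro z _
    have := hc z
    simp only [Finset.coe_insert, Finset.coe_singleton, mem_insert_iff, mem_singleton_iff]
    tauto
  have h := ncard_le_ncard hsub
  rw [ncard_univ, natCard, ncard_coe_finset] at h
  have := Finset.card_le_four (a := a) (b := b) (c := c) (d := d)
  omega

theorem isHub_hub : (marking k p).IsHub hub := by
  intro o
  constructor
  · rintro ⟨u, v, a, b, huv, hu, hv⟩
    cases hu <;> cases hv <;> simp_all
  · rintro rfl
    exact ⟨hubMid false, hubMid true, _, _, by simp, .hub_left _, .hub_left _⟩

theorem midsAwayFrom_hub : (marking k p).midsAwayFrom hub = range mid := by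
  ext x
  constructor
  · rintro ⟨⟨a, b, h⟩, h'⟩
    cases h with
    | hub_left s => exact (h' ⟨_, .hub_left s⟩).elim
    | hub_right s => exact (h' ⟨_, .hub_left s⟩).elim
    | tip_left j => exact ⟨j, rfl⟩
    | tip_right j => exact ⟨j, rfl⟩
  · rintro ⟨j, rfl⟩
    refine ⟨⟨_, _, .tip_left j⟩, ?_⟩
    rintro ⟨b, h⟩
    cases h

theorem isFree_iff {x : ChainPoint k p} : (marking k p).IsFree x ↔ x ∈ range free := by
  constructor
  · intro h
    match x with
    | hub => exact ((h _ _).2 (.hub_left true)).elim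
    | hubMid s => exact ((h _ _).1 (.hub_left s)).elim
    | hubEnd s => exact ((h _ _).2 (.hub_right s)).elim
    | mid j => exact ((h _ _).1 (.tip_left j)).elim
    | tip j false => exact ((h _ _).2 (.tip_left j)).elim
    | tip j true => exact ((h _ _).2 (.tip_right j)).elim
    | free i => exact ⟨i, rfl⟩
  · rintro ⟨i, rfl⟩ a b
    constructor <;> rintro h <;> cases h

/-- The free points in their order, with the `j`-th edge just before the free point `g j`. -/
def position (g : Fin k → ℕ) : ChainPoint k p → ℤ
  | hub => -10
  | hubMid s => -10 + if s then 1 else -1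
  | hubEnd s => -10 + if s then 2 else -2
  | mid j => 4 * g j - 2
  | tip j s => 4 * g j - 2 + if s then 1 else -1
  | free i => 4 * i

theorem isPlacement_position {g : Fin k → ℕ} (hg : Function.Injective g) :
    (marking k p).IsPlacement (position g) := by
  constructor
  · intro x y h
    have hg' : ∀ i j, (g i : ℤ) = g j → i = j := fun i j h => hg (by exact_mod_cast h)
    cases x <;> cases y <;> simp only [position] at h <;> grind
  · intro x a b h
    cases h <;> simp only [position] <;> grind

theorem natCard_midsAwayFrom : ((marking k p).midsAwayFrom hub).ncard = k := by
  rw [midsAwayFrom_hub, ← image_univ, ncard_image_of_injective _ fun i j h => by simpa using h,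
    ncard_univ, Nat.card_fin]

/-- Free points and midpoints away from the hub all lie to the right of the hub, so cutting there
gives their order by position. Spacing 4 leaves three places between consecutive free points for an
edge with its midpoint. -/
theorem cyc_hub_free_mid_iff {g : Fin k → ℕ} (hg : Function.Injective g) {i : Fin p} {j : Fin k} :
    (marking k p).Cyc (IsPositive (orderTypeOf ((marking k p).parabola (position g))))
      hub (free i) (mid j) ↔ (i : ℕ) < g j := by
  have h := isPlacement_position (p := p) hg
  have hC := (Marking.isChirotope_of_isRealization _ h.isRealization).isCyclicOrder
  have hmk : ¬ (marking k p).IsMarked hub (free i) (mid j) := by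
    rintro (h | h | h) <;> cases h
  have hmk' : ¬ (marking k p).IsMarked hub (mid j) (free i) := by
    rintro (h | h | h) <;> cases h
  constructor
  · intro hc
    by_contra hlt
    refine hC.asymm hc ⟨by simp, by simp, by simp, ⟨fun _ => hmk', fun _ => ?_⟩⟩
    refine isPositive_orderTypeOf.2 ⟨by simp, by simp, by simp, h.signedArea_pos ?_ ?_ ?_⟩
    · simp only [position]; omega
    · simp only [position]; omega
    · rintro ⟨⟩
  · intro hlt
    refine ⟨by simp, by simp, by simp, ⟨fun _ => hmk, fun _ => ?_⟩⟩
    refine isPositive_orderTypeOf.2 ⟨by simp, by simp, by simp, h.signedArea_pos ?_ ?_ ?_⟩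
    · simp only [position]; omega
    · simp only [position]; omega
    · rintro ⟨⟩

theorem freeRanks_position {g : Fin k → ℕ} (hg : Function.Injective g) (hgp : ∀ j, g j ≤ p) :
    (marking k p).freeRanks hub
      (IsPositive (orderTypeOf ((marking k p).parabola (position g)))) = range g := by
  rw [Marking.freeRanks, midsAwayFrom_hub, ← range_comp]
  congr 1
  ext j
  have : {x : ChainPoint k p | (marking k p).IsFree x ∧
      (marking k p).Cyc (IsPositive (orderTypeOf ((marking k p).parabola (position g))))
        hub x (mid j)} = free '' {i | (i : ℕ) < g j} := by
    ext x
    simp only [mem_ofPred_eq, isFree_iff, mem_image]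
    constructor
    · rintro ⟨⟨i, rfl⟩, h⟩
      exact ⟨i, (cyc_hub_free_mid_iff hg).1 h, rfl⟩
    · rintro ⟨i, hi, rfl⟩
      exact ⟨⟨i, rfl⟩, (cyc_hub_free_mid_iff hg).2 hi⟩
  simp only [Function.comp_apply]
  rw [this, ncard_image_of_injective _ fun i j h => by simpa using h,
    ← ncard_image_of_injective _ Fin.val_injective]
  -- The bound `g j ≤ p` ensures that all `g j` indices below `g j` belong to free points.
  have : Fin.val '' {i : Fin p | (i : ℕ) < g j} = (Finset.range (g j) : Set ℕ) := by
    ext m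
    simp only [mem_image, mem_ofPred_eq, Finset.coe_range, mem_Iio]
    constructor
    · rintro ⟨i, hi, rfl⟩
      exact hi
    · exact fun hm => ⟨⟨m, hm.trans_le (hgp j)⟩, hm, rfl⟩
  rw [this, ncard_coe_finset, Finset.card_range]

theorem choose_le_ncard_orderTypeClasses (k p : ℕ) :
    p.choose k ≤ (orderTypeClasses (marking k p).closure).ncard := by
  have key : ∀ S ∈ (Finset.powersetCard k (Finset.range p) : Set (Finset ℕ)),
      ∃ t ∈ orderTypes (marking k p).closure,
        (marking k p).freeRanks hub (IsPositive t) = S := by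
    intro S hS
    obtain ⟨hSp, hSk⟩ := Finset.mem_powersetCard.1 hS
    have hg : Function.Injective (S.orderEmbOfFin hSk) := (S.orderEmbOfFin hSk).injective
    refine ⟨_, ⟨_, (isPlacement_position hg).isRealization, rfl⟩, ?_⟩
    rw [freeRanks_position hg, Finset.range_orderEmbOfFin]
    intro j
    exact (Finset.mem_range.1 (hSp (S.orderEmbOfFin_mem hSk j))).le
  choose! t ht hts using key
  have h := ncard_le_ncard_of_injOn (t := orderTypeClasses (marking k p).closure)
    (fun S => Quotient.mk (orderTypeSetoid _) (t S)) (fun S hS => mem_image_of_mem _ (ht S hS))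
    (fun S hS S' hS' h => ?_) (orderTypeClasses_finite _)
  · rwa [ncard_coe_finset, Finset.card_powersetCard, Finset.card_range] at h
  · obtain ⟨δ, hδ⟩ := orderTypeSetoid_iff_isPositive.1 (Quotient.exact h)
    obtain ⟨f, hf, hft⟩ := ht S hS
    obtain ⟨f', hf', hft'⟩ := ht S' hS'
    have hP : (marking k p).IsChirotope (IsPositive (t S)) :=
      hft ▸ Marking.isChirotope_of_isRealization _ hf
    have hP' : (marking k p).IsChirotope (IsPositive (t S')) :=
      hft' ▸ Marking.isChirotope_of_isRealization _ hf'
    have := hP'.freeRanks_eq hP exists_ne isHub_hub hδ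
    rw [hts S hS, hts S' hS'] at this
    exact (Finset.coe_injective this).symm

/-- `midRanks` of a representative is a `k`-subset of the possible ranks and determines the class.
-/
theorem ncard_orderTypeClasses_le (k p : ℕ) :
    (orderTypeClasses (marking k p).closure).ncard ≤ (p + (3 * k + 5)).choose k := by
  have key : ∀ q ∈ orderTypeClasses (marking k p).closure, ∃ t,
      (marking k p).IsChirotope (IsPositive t) ∧ Quotient.mk (orderTypeSetoid _) t = q := by
    rintro _ ⟨_, ⟨f, hf, rfl⟩, rfl⟩
    exact ⟨_, Marking.isChirotope_of_isRealization _ hf, rfl⟩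
  choose! t ht htq using key
  have hfin : ∀ q, ((marking k p).midRanks hub (IsPositive (t q))).Finite :=
    fun q => (Set.toFinite _).image _
  have h := ncard_le_ncard_of_injOn (s := orderTypeClasses (marking k p).closure)
    (t := (Finset.powersetCard k (Finset.range (p + (3 * k + 5))) : Set (Finset ℕ)))
    (fun q => (hfin q).toFinset) (fun q hq => ?_) (fun q hq q' hq' h => ?_) (Finset.finite_toSet _)
  · rwa [ncard_coe_finset, Finset.card_powersetCard, Finset.card_range] at h
  · have hC := (ht q hq).isCyclicOrder
    refine Finset.mem_powersetCard.2 ⟨?_, ?_⟩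
    · intro m hm
      obtain ⟨x, -, rfl⟩ := (hfin q).mem_toFinset.1 hm
      rw [Finset.mem_range, ← natCard k p]
      exact hC.rank_lt_card x
    · rw [← ncard_eq_toFinset_card _ (hfin q), Marking.midRanks,
        ncard_image_of_injective _ hC.rank_injective, natCard_midsAwayFrom]
  · rw [← htq q hq, ← htq q' hq']
    refine (Quotient.sound (orderTypeSetoid_iff_isPositive.2 ?_)).symm
    exact (ht q hq).exists_equiv (ht q' hq') isHub_hub (Set.Finite.toFinset_inj.1 h)

end ChainPoint

/-! ### Asymptotics -/

theorem tendsto_choose_add_div_pow (k m : ℕ) :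
    Tendsto (fun p : ℕ => ((p + m).choose k : ℝ) / (p : ℝ) ^ k) atTop
      (𝓝 (1 / (k.factorial : ℝ))) := by
  have hk : (k.factorial : ℝ) ≠ 0 := mod_cast k.factorial_ne_zero
  have h1 : Tendsto (fun n : ℕ => (n.choose k : ℝ) / ((n : ℝ) ^ k / k.factorial)) atTop (𝓝 1) := by
    refine (Asymptotics.isEquivalent_iff_tendsto_one ?_).1 (isEquivalent_choose k)
    filter_upwards [eventually_gt_atTop 0] with n hn
    positivity
  have h2 := (tendsto_add_atTop_iff_nat m).2 h1
  -- This factor replaces `(p + m) ^ k` by `p ^ k` in the denominator.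
  have h3 : Tendsto (fun p : ℕ => ((p : ℝ) / (p + m : ℝ))⁻¹ ^ k) atTop (𝓝 (1⁻¹ ^ k)) :=
    ((tendsto_natCast_div_add_atTop (m : ℝ)).inv₀ one_ne_zero).pow k
  have h4 := (h2.mul h3).mul_const (1 / (k.factorial : ℝ))
  rw [inv_one, one_pow, one_mul, one_mul] at h4
  refine h4.congr' ?_
  filter_upwards [eventually_gt_atTop 0] with p hp
  have hp' : (0 : ℝ) < p := by exact_mod_cast hp
  have hpm : (p : ℝ) + m ≠ 0 := by positivity
  push_cast
  rw [inv_div, div_pow]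
  field_simp

theorem mainTheorem4 (k : ℕ) :
    ∃ (J : ℕ → Type) (_ : ∀ p, Finite (J p)) (cl : ∀ p, ClosureOperator (Set (J p))),
      (∀ p, k < p →
        IsConvexFourGeometry (cl p) ∧ IsRealizable (cl p) ∧ HasExactlyLayers (cl p) 2) ∧
      HasGrowth (fun p => Nat.card (J p)) 1 ∧
      HasGrowth (fun p => (orderTypeClasses (cl p)).ncard) k := by
  refine ⟨ChainPoint k, fun p => inferInstance, fun p => (ChainPoint.marking k p).closure,
    fun p _ => ⟨Marking.isConvexFourGeometry_closure _, ?_, ?_⟩, ?_, ?_⟩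
  · exact ⟨_, (ChainPoint.isPlacement_position Fin.val_injective).isRealization⟩
  · refine Marking.hasExactlyLayers_closure _ ⟨_, _, _, .hub_left true⟩ fun a b x => ?_
    obtain ⟨z, h1, h2, h3, -⟩ := ChainPoint.exists_ne a b x x
    exact ⟨z, h1, h2, h3⟩
  · refine ⟨1, one_pos, ?_⟩
    -- The cardinality `p + (3 * k + 5)` is its own binomial coefficient over 1.
    simpa [ChainPoint.natCard] using tendsto_choose_add_div_pow 1 (3 * k + 5)
  · refine ⟨1 / (k.factorial : ℝ), by positivity, ?_⟩
    refine tendsto_of_tendsto_of_tendsto_of_le_of_le (tendsto_choose_add_div_pow k 0)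
      (tendsto_choose_add_div_pow k (3 * k + 5)) (fun p => ?_) (fun p => ?_)
    · have := ChainPoint.choose_le_ncard_orderTypeClasses k p
      simp only [add_zero]
      gcongr
    · have := ChainPoint.ncard_orderTypeClasses_le k p
      simp only
      gcongr
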